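/- Graphs are finite, undirected, with positive real edge lengths; \(d_G\) is the shortest-path distance (\(\infty\) between different components) and \(B_v(\rho)=\{u : d_G(v,u)\le \rho\}\). Fix a constant \(c>4\). The highway dimension of a graph \(G\) is the smallest integer \(\eta\) such that for every real \(r>0\) and every vertex \(v\) there is a set of at most \(\eta\) vertices in \(B_v(cr)\) that intersects every shortest path of length at least \(r\) contained in \(B_v(cr)\). The width of a tree decomposition is the size of its largest bag minus one, and the treewidth of a graph is the minimum width of its tree decompositions. An embedding of a guest graph \(G=(V,E)\) is a mapping \(\phi\) from the vertices of \(G\) to the vertices of a host graph \(H=(V,E_H)\) on the same vertex set. **Theorem.** There is a function \(f(\cdot,\cdot)\) (depending only on \(c\)) such that for every \(\varepsilon>0\), every integer \(\eta\ge 0\), every graph \(G\) of highway dimension at most \(\eta\) and every vertex \(s\) of \(G\), there exist a graph \(H\) and an embedding \(\phi\) of \(G\) into \(H\) such that * \(H\) has treewidth at most \(f(\varepsilon,\eta)\), and * for all vertices \(u\) and \(v\) of \(G\), \[ d_G(u,v)\;\le\; d_H(\phi(u),\phi(v))\;\le\; d_G(u,v)+\varepsilon\,\bigl(d_G(s,u)+d_G(s,v)\bigr).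 \] -/

import Mathlib

open scoped ENNReal

/-- An undirected graph on `V` in which every edge has a positive real length.
(The values of `len` on pairs that are not edges play no role.) -/
structure LengthGraph (V : Type*) where
  graph : SimpleGraph V
  len : Sym2 V → ℝ
  len_pos : ∀ e ∈ graph.edgeSet, 0 < len e

namespace LengthGraph

variable {V : Type*}

/-- The length of a walk: the sum of the lengths of the edges it traverses. -/
def walkLength (G : LengthGraph V) {u v : V} (p : G.graph.Walk u v) : ℝ :=
  (p.edges.map G.len).sum

/-- The shortest-path distance `d_G(u, v)`; it is `∞` if no walk joins `u` to `v`. -/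
noncomputable def dist (G : LengthGraph V) (u v : V) : ℝ≥0∞ :=
  ⨅ p : G.graph.Walk u v, ENNReal.ofReal (G.walkLength p)

/-- The ball `B_v(r) = {u | d_G(v, u) ≤ r}`. -/
def ball (G : LengthGraph V) (v : V) (r : ℝ) : Set V :=
  {u | G.dist v u ≤ ENNReal.ofReal r}

/-- `p` is a shortest path between its ends. (As lengths are positive, such a walk repeats no
vertex.) -/
def IsShortestPath (G : LengthGraph V) {u v : V} (p : G.graph.Walk u v) : Prop :=
  ∀ q : G.graph.Walk u v, G.walkLength p ≤ G.walkLength q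

/-- For every scale `r > 0` and every vertex `v` there are at most `η` vertices in `B_v(c r)`
that meet every shortest path of length at least `r` lying in `B_v(c r)`. -/
def HasLocalHubs (G : LengthGraph V) (c : ℝ) (η : ℕ) : Prop :=
  ∀ (r : ℝ) (v : V), 0 < r →
    ∃ S : Finset V, S.card ≤ η ∧ (∀ x ∈ S, x ∈ G.ball v (c * r)) ∧
      ∀ (a b : V) (p : G.graph.Walk a b), G.IsShortestPath p → r ≤ G.walkLength p →
        (∀ x ∈ p.support, x ∈ G.ball v (c * r)) → ∃ x ∈ p.support, x ∈ S

/-- The highway dimension of `G` with respect to the constant `c`: the smallest `η` such that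
`G.HasLocalHubs c η` (it is `∞` if there is none, which cannot happen for finite `V`). -/
noncomputable def highwayDimension (G : LengthGraph V) (c : ℝ) : ℕ∞ :=
  ⨅ (η : ℕ) (_ : G.HasLocalHubs c η), (η : ℕ∞)

end LengthGraph

/-- A tree decomposition of a graph on `V`: a finite tree whose nodes carry bags of vertices. -/
structure TreeDecomposition {V : Type*} (G : SimpleGraph V) where
  Node : Type
  [fintypeNode : Fintype Node]
  tree : SimpleGraph Node
  isTree : tree.IsTree
  bag : Node → Finset V
  /-- Every vertex is in a bag. -/
  exists_mem_bag : ∀ v : V, ∃ i, v ∈ bag i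
  /-- Every edge is in a bag. -/
  exists_edge_bag : ∀ u v : V, G.Adj u v → ∃ i, u ∈ bag i ∧ v ∈ bag i
  /-- The bags that contain a given vertex form a connected subtree. -/
  connected_bags : ∀ v : V, (tree.induce {i | v ∈ bag i}).Connected

attribute [instance] TreeDecomposition.fintypeNode

/-- The width of a tree decomposition: the size of the largest bag minus one. -/
def TreeDecomposition.width {V : Type*} {G : SimpleGraph V} (D : TreeDecomposition G) : ℕ :=
  Finset.univ.sup (fun i => (D.bag i).card) - 1

/-- The treewidth of a graph: the minimum width of its tree decompositions (`∞` if it has none,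
which cannot happen for finite `V`). -/
noncomputable def treewidth {V : Type*} (G : SimpleGraph V) : ℕ∞ :=
  ⨅ D : TreeDecomposition G, (D.width : ℕ∞)

/-!
The embedding is the identity on vertices, and `H` joins pairs of vertices by edges as long as their
distance in `G`. So distances cannot shrink, vertices outside the component of `s` stay isolated,
and it remains to find a sparse set of shortcuts, of bounded treewidth, over which any two vertices
`u` and `v` of the component have a two-edge detour of small extra length. That component is a
metric space, and highway dimension is used only in the metric form `HasMetricHubs`.

Let the levels `k` carry the scales `lam ^ k`, with `1 < lam ≤ 2` and `2 * lam ≤ c - 2`; here `4 <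
c` is needed. A town of scale `r` is a ball of radius `r` that has diameter less than `r` and is at
distance at least `r` from all other points. A point `v` that is in no town of scale `r` has a
geodesic of length at least `r` near it (`exists_geodesic_of_not_isTown`), hence a hub within
distance `2 * r`. Applying this from each level to the next, a net of bounded size around a centre
serves, over boundedly many levels, every point near the centre for as long as that point is in no
town of the levels passed (`exists_isNet`).

Let `e` be the smaller of `1 / 4` and `ε / 6`. Nets are placed in the towns that do not contain `s`
and whose scale is within a bounded factor of their distance from `s`, and around `s` itself at
every level. Given `u` and `v` with `v` farther from `s`, go up from the scale of `dist v u` (or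
from `e` times the distance of `v` from `s`, if that is larger) to the first level where `v` is in a
town or the scale exceeds twice the distance of `v` from `s`. The net of that town, or the net
around `s`, then has a point on a geodesic from `v` to `u`, or close to `v`
(`exists_level_with_short_detour`). If `u` or that net point is close to `s`, the detour goes over
`s` instead.

The hubs of the towns of `u`, the root hubs at a distance from `s` comparable to that of `u`, and
`s` form the bag of `u` (`InBag`). Towns are nested, so if town hubs are ordered by their highest
level, and root hubs come after them by increasing distance from `s`, then the bags form a perfect
elimination scheme (`inBag_closed`). Only boundedly many levels contribute to a bag
(`ncard_inBag_le`), and a perfect elimination scheme with bounded bags bounds the treewidth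
(`treewidth_le_of_elimination`).
-/

/-! ### Treewidth from an elimination order -/

/-- The graph in which every node of a finite linear order other than the root is joined to a
strictly larger parent is a tree. -/
theorem isTree_fromRel_parent {N : Type*} [Finite N] [LinearOrder N] (p : N → N) (root : N)
    (hroot : p root = root) (hp : ∀ i, i ≠ root → i < p i) :
    (SimpleGraph.fromRel (fun i j => p i = j)).IsTree := by
  classical
  have := Fintype.ofFinite N
  set T := SimpleGraph.fromRel (fun i j => p i = j) with hT
  have hconn : T.Connected := by
    rw [SimpleGraph.connected_iff_exists_forall_reachable]
    refine ⟨root, fun i => SimpleGraph.Reachable.symm ?_⟩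
    induction i using (Finite.to_wellFoundedGT (α := N)).wf.induction with
    | _ i ih =>
      by_cases hi : i = root
      · rw [hi]
      · have hlt := hp i hi
        have hadj : T.Adj i (p i) := by
          rw [hT, SimpleGraph.fromRel_adj]
          exact ⟨hlt.ne, Or.inl rfl⟩
        exact hadj.reachable.trans (ih _ hlt)
  rw [SimpleGraph.isTree_iff_connected_and_card]
  refine ⟨hconn, le_antisymm ?_ hconn.card_vert_le_card_edgeSet_add_one⟩
  -- every edge is `s(i, p i)` for some `i ≠ root`
  have hsub : T.edgeSet ⊆
      ((Finset.univ.erase root).image (fun i => s(i, p i)) : Finset (Sym2 N)) := by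
    intro e
    induction e using Sym2.ind with
    | _ a b =>
      intro h
      rw [SimpleGraph.mem_edgeSet, hT, SimpleGraph.fromRel_adj] at h
      rw [Finset.mem_coe, Finset.mem_image]
      obtain ⟨hne, h | h⟩ := h
      · refine ⟨a, ?_, by rw [h]⟩
        rw [Finset.mem_erase]
        exact ⟨fun ha => hne (by rw [← h, ha, hroot]), Finset.mem_univ _⟩
      · refine ⟨b, ?_, by rw [h, Sym2.eq_swap]⟩
        rw [Finset.mem_erase]
        exact ⟨fun hb => hne (by rw [← h, hb, hroot]), Finset.mem_univ _⟩
  have h1 : T.edgeSet.ncard ≤ (Finset.univ.erase root).card := by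
    refine (Set.ncard_le_ncard hsub (Finset.finite_toSet _)).trans ?_
    rw [Set.ncard_coe_finset]
    exact Finset.card_image_le
  have h2 : (Finset.univ.erase root).card + 1 = Fintype.card N :=
    Finset.card_erase_add_one (Finset.mem_univ root)
  rw [Nat.card_coe_set_eq, Nat.card_eq_fintype_card]
  omega

/-- A perfect elimination scheme bounds the treewidth. The relation `R u x` says that `x` may stand
in the bag of `u`; the hypothesis `hclosed` says that among two members of the bag of `u`, the one
with the smaller key has the other one in its bag. The bag of `u` is then `u` together with the
members of `{x | R u x}` that come after `u`, and its parent is the first of these. -/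
theorem treewidth_le_of_elimination {V κ : Type*} [Finite V] [Nonempty V] [LinearOrder κ]
    (G : SimpleGraph V)
    (R : V → V → Prop) (key : V → κ) (w : ℕ) (hrefl : ∀ u, R u u)
    (hclosed : ∀ u x y, R u x → R u y → key x ≤ key y → R x y)
    (hcard : ∀ u, {x | R u x}.ncard ≤ w + 1)
    (hadj : ∀ u v, G.Adj u v → R u v ∨ R v u) : treewidth G ≤ w := by
  classical
  have := Fintype.ofFinite V
  -- ties of `key` are broken by an arbitrary enumeration
  obtain ⟨n, e, he⟩ : ∃ (n : ℕ) (e : V ≃ Fin n), ∀ x y, e x ≤ e y → key x ≤ key y := by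
    let g : V → κ ×ₗ Fin (Fintype.card V) := fun x => toLex (key x, Fintype.equivFin V x)
    have hg : Function.Injective g := fun x y h => by
      have := congrArg (fun z => (ofLex z).2) h
      simpa [g] using this
    let inst : LinearOrder V := LinearOrder.lift' g hg
    let o := monoEquivOfFin V rfl
    refine ⟨_, o.symm.toEquiv, fun x y h => ?_⟩
    have h1 : x ≤ y := o.symm.le_iff_le.mp h
    have h2 : g x ≤ g y := h1
    rw [Prod.Lex.toLex_le_toLex] at h2
    rcases h2 with h2 | h2
    · exact h2.le
    · exact h2.1.le
  obtain ⟨v0⟩ := ‹Nonempty V›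
  have hn : 0 < n := (Nat.zero_le _).trans_lt (e v0).2
  have : NeZero n := ⟨hn.ne'⟩
  let Q : Fin n → Fin n → Prop := fun i j => i < j ∧ R (e.symm i) (e.symm j)
  have hQ : ∀ i j k, Q i j → Q i k → j < k → Q j k := fun i j k h1 h2 h3 =>
    ⟨h3, hclosed _ _ _ h1.2 h2.2 (he _ _ (by simpa using h3.le))⟩
  obtain ⟨root, hroot⟩ : ∃ root : Fin n, ∀ i, i ≤ root := ⟨⟨n - 1, by omega⟩, fun i => by
    rw [Fin.le_def]
    have := i.2
    simp only
    omega⟩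
  have hpar : ∀ i, ∃ j, (i ≠ root → i < j) ∧ (i = root → j = root) ∧
      ∀ k, Q i k → Q i j ∧ j ≤ k := by
    intro i
    by_cases h : ∃ k, Q i k
    · have hne : (Finset.univ.filter (Q i)).Nonempty := by
        obtain ⟨k, hk⟩ := h
        exact ⟨k, by simpa using hk⟩
      have hmem := Finset.min'_mem _ hne
      rw [Finset.mem_filter] at hmem
      refine ⟨_, fun _ => hmem.2.1, fun hi => ?_, fun k hk => ⟨hmem.2, ?_⟩⟩
      · exact absurd (hmem.2.1.trans_le (hroot _)) (by rw [hi]; exact lt_irrefl _)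
      · exact Finset.min'_le _ _ (by simpa using hk)
    · exact ⟨root, fun hi => lt_of_le_of_ne (hroot i) hi, fun _ => rfl,
        fun k hk => absurd ⟨k, hk⟩ h⟩
  choose p hp1 hp2 hp3 using hpar
  let bag : Fin n → Finset V := fun i =>
    Finset.univ.filter (fun x => e x = i ∨ Q i (e x))
  have hbag : ∀ i x, x ∈ bag i ↔ (e x = i ∨ Q i (e x)) := by simp [bag]
  have hedge : ∀ u v, e u < e v → (R u v ∨ R v u) → ∃ i, u ∈ bag i ∧ v ∈ bag i := by
    intro u v huv h
    refine ⟨e u, by simp [hbag], ?_⟩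
    rw [hbag]
    refine Or.inr ⟨huv, ?_⟩
    rw [Equiv.symm_apply_apply, Equiv.symm_apply_apply]
    rcases h with h | h
    · exact h
    · exact hclosed v u v h (hrefl v) (he _ _ huv.le)
  let D : TreeDecomposition G :=
    { Node := Fin n
      tree := SimpleGraph.fromRel (fun i j => p i = j)
      isTree := isTree_fromRel_parent p root (hp2 root rfl) hp1
      bag := bag
      exists_mem_bag := fun v => ⟨e v, by simp [hbag]⟩
      exists_edge_bag := by
        intro u v huv
        rcases lt_trichotomy (e u) (e v) with h | h | h
        · exact hedge u v h (hadj u v huv)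
        · exact absurd (e.injective h) huv.ne
        · obtain ⟨i, h1, h2⟩ := hedge v u h (hadj u v huv).symm
          exact ⟨i, h2, h1⟩
      connected_bags := by
        intro x
        rw [SimpleGraph.connected_iff_exists_forall_reachable]
        refine ⟨⟨e x, by simp [hbag]⟩, ?_⟩
        rintro ⟨i, hi⟩
        refine SimpleGraph.Reachable.symm ?_
        induction i using (Finite.to_wellFoundedGT (α := Fin n)).wf.induction with
        | _ i ih =>
          by_cases hix : e x = i
          · subst hix; rfl
          · have hq : Q i (e x) := ((hbag _ _).mp hi).resolve_left hix
            obtain ⟨hq1, hq2⟩ := hp3 i _ hq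
            have hmem : x ∈ bag (p i) := by
              rw [hbag]
              rcases hq2.eq_or_lt with h | h
              · exact Or.inl h.symm
              · exact Or.inr (hQ _ _ _ hq1 hq h)
            refine SimpleGraph.Reachable.trans (SimpleGraph.Adj.reachable ?_)
              (ih (p i) hq1.1 hmem)
            rw [SimpleGraph.induce_adj, SimpleGraph.fromRel_adj]
            exact ⟨hq1.1.ne, Or.inl rfl⟩ }
  refine iInf_le_of_le D ?_
  have hw : D.width ≤ w := by
    unfold TreeDecomposition.width
    refine Nat.sub_le_of_le_add (Finset.sup_le fun i _ => ?_)
    refine le_trans ?_ (hcard (e.symm i))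
    rw [← Set.ncard_coe_finset]
    refine Set.ncard_le_ncard (fun x hx => ?_) (Set.toFinite _)
    rcases (hbag _ _).mp hx with h | h
    · subst h
      simpa using hrefl x
    · simpa using h.2
  exact_mod_cast hw

/-! ### Towns and nets -/

section Metric

variable {V : Type*} [MetricSpace V]

/-- The metric content of highway dimension at most `η`: for every scale `r` and every centre `v`,
some set of at most `η` points meets every geodesic of length at least `r` that stays within
distance `c * r` of `v`. The geodesic is the metric interval between its ends `a` and `b`. -/
def HasMetricHubs (V : Type*) [MetricSpace V] (c : ℝ) (η : ℕ) : Prop :=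
  ∀ (r : ℝ) (v : V), 0 < r → ∃ S : Finset V, S.card ≤ η ∧
    ∀ a b, r ≤ dist a b → (∀ x, dist a x + dist x b = dist a b → dist v x ≤ c * r) →
      ∃ x ∈ S, dist a x + dist x b = dist a b

/-- The open ball of radius `r` about `v` is a town: it is the open `r`-ball about each of its
points. So it has diameter less than `r`, and all other points are at distance at least `r`. -/
def IsTown (r : ℝ) (v : V) : Prop :=
  ∀ a b, dist v a < r → (dist v b < r ↔ dist a b < r)

theorem IsTown.ball_eq {r : ℝ} {v x : V} (h : IsTown r v) (hx : dist v x < r) :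
    Metric.ball x r = Metric.ball v r := by
  ext y
  rw [Metric.mem_ball, Metric.mem_ball, dist_comm y x, dist_comm y v]
  exact (h x y hx).symm

theorem IsTown.of_dist_lt {r : ℝ} {v x : V} (h : IsTown r v) (hx : dist v x < r) :
    IsTown r x := by
  intro a b ha
  rw [← h x a hx] at ha
  rw [← h x b hx]
  exact h a b ha

/-- Near a point that is in no town of scale `r` there is a geodesic of length at least `r`. -/
theorem exists_geodesic_of_not_isTown {r : ℝ} {v : V} (h : ¬ IsTown r v) :
    ∃ a b : V, r ≤ dist a b ∧ ∀ x, dist a x + dist x b = dist a b → dist v x ≤ 2 * r := by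
  unfold IsTown at h
  push Not at h
  obtain ⟨a, b, ha, h | h⟩ := h
  · refine ⟨a, b, h.2, fun x hx => ?_⟩
    have := dist_triangle v a x
    have := dist_triangle v b x
    have := dist_triangle a v b
    rw [dist_comm a v] at this
    rw [dist_comm x b] at hx
    linarith [h.1]
  · refine ⟨v, b, h.1, fun x hx => ?_⟩
    have := dist_triangle v a b
    have := dist_nonneg (x := x) (y := b)
    linarith [h.2]

/-- A hub set at scale `r` about `h`: it meets every geodesic of length between `r` and `2 r` that
starts within `(c - 2) r` of `h`, and it comes within `2 r` of each point there that is in no town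
of scale `r`. -/
theorem HasMetricHubs.exists_hubs {c : ℝ} {η : ℕ} (hub : HasMetricHubs V c η) {r : ℝ}
    (hr : 0 < r) (h : V) : ∃ S : Finset V, S.card ≤ η ∧ ∀ v, dist h v ≤ (c - 2) * r →
      (¬ IsTown r v → ∃ x ∈ S, dist v x ≤ 2 * r) ∧
      ∀ u, r ≤ dist v u → dist v u ≤ 2 * r → ∃ x ∈ S, dist v x + dist x u = dist v u := by
  obtain ⟨S, hS, H⟩ := hub r h hr
  refine ⟨S, hS, fun v hv => ⟨fun ht => ?_, fun u hu1 hu2 => ?_⟩⟩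
  · obtain ⟨a, b, hab, hx⟩ := exists_geodesic_of_not_isTown ht
    obtain ⟨x, hxS, hxb⟩ := H a b hab fun x hxb => by
      have := dist_triangle h v x
      linarith [hx x hxb]
    exact ⟨x, hxS, hx x hxb⟩
  · refine H v u hu1 fun x hx => ?_
    have := dist_triangle h v x
    have := dist_nonneg (x := x) (y := u)
    linarith

/-- `IsNet lam h K n X`: the set `X` contains the centre `h`, and for every point `v` within
`2 * lam ^ K` of `h` and every level `K - j` with `j ≤ n`, it comes close to `v` as long as `v` is
in no town of the levels from `K - 1` down to `K - j`, and it meets the geodesics from `v` of length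
about `lam ^ (K - j)` as long as `v` is in no town of the levels strictly between `K` and
`K - j`. -/
structure IsNet (lam : ℝ) (h : V) (K : ℤ) (n : ℕ) (X : Finset V) : Prop where
  center : h ∈ X
  close : ∀ v, dist h v ≤ 2 * lam ^ K → ∀ j : ℕ, j ≤ n →
    (∀ i : ℕ, 1 ≤ i → i ≤ j → ¬ IsTown (lam ^ (K - i)) v) →
      ∃ x ∈ X, dist v x ≤ 2 * lam ^ (K - j)
  hit : ∀ v, dist h v ≤ 2 * lam ^ K → ∀ j : ℕ, 1 ≤ j → j ≤ n →
    (∀ i : ℕ, 1 ≤ i → i < j → ¬ IsTown (lam ^ (K - i)) v) →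
      ∀ u, lam ^ (K - j) ≤ dist v u → dist v u ≤ 2 * lam ^ (K - j) →
        ∃ x ∈ X, dist v x + dist x u = dist v u

/-- The number of points that suffice for a net over `n` levels. -/
def netCard (η : ℕ) : ℕ → ℕ
  | 0 => 1
  | n + 1 => 1 + η * netCard η n

/-- Nets of bounded size exist: hubs of one level serve as centres for the next. The radii match
because `2 * lam ≤ c - 2`. -/
theorem exists_isNet {c lam : ℝ} {η : ℕ} (hub : HasMetricHubs V c η) (hlam : 0 < lam)
    (hc : 2 * lam ≤ c - 2) (n : ℕ) :
    ∀ (h : V) (K : ℤ), ∃ X : Finset V, X.card ≤ netCard η n ∧ IsNet lam h K n X := by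
  classical
  induction n with
  | zero =>
    intro h K
    refine ⟨{h}, by simp [netCard], by simp, fun v hv j hj _ => ⟨h, by simp, ?_⟩,
      fun v hv j hj hj' => by omega⟩
    obtain rfl : j = 0 := by omega
    simpa [dist_comm] using hv
  | succ n ih =>
    intro h K
    choose X hXc hX using ih
    have hpos : 0 < lam ^ (K - 1) := zpow_pos hlam _
    obtain ⟨S, hS, H⟩ := hub.exists_hubs hpos h
    have hK : 2 * lam ^ K ≤ (c - 2) * lam ^ (K - 1) := by
      have : lam ^ K = lam * lam ^ (K - 1) := by
        rw [← zpow_one_add₀ hlam.ne']; congr 1; ring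
      rw [this, ← mul_assoc]
      exact mul_le_mul_of_nonneg_right hc hpos.le
    have hlevel : ∀ j : ℕ, K - 1 - (j : ℤ) = K - ((j + 1 : ℕ) : ℤ) := fun j => by
      push_cast; ring
    refine ⟨insert h (S.biUnion fun x => X x (K - 1)), ?_, by simp, ?_, ?_⟩
    · refine (Finset.card_insert_le _ _).trans ?_
      have := Finset.card_biUnion_le_card_mul S (fun x => X x (K - 1)) (netCard η n)
        (fun x _ => hXc _ _)
      have := this.trans (Nat.mul_le_mul_right _ hS)
      simp only [netCard]
      omega
    · intro v hv j hj ht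
      rcases j with _ | j
      · exact ⟨h, by simp, by simpa [dist_comm] using hv⟩
      have ht1 : ¬ IsTown (lam ^ (K - 1)) v := by simpa using ht 1 le_rfl (by omega)
      obtain ⟨y, hyS, hy⟩ := (H v (hv.trans hK)).1 ht1
      obtain ⟨x, hx, hxv⟩ := (hX y (K - 1)).close v (by rwa [dist_comm]) j (by omega)
        fun i hi1 hi2 => by
          rw [hlevel]
          exact ht (i + 1) (by omega) (by omega)
      refine ⟨x, Finset.mem_insert_of_mem (Finset.mem_biUnion.mpr ⟨y, hyS, hx⟩), ?_⟩
      rwa [hlevel] at hxv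
    · intro v hv j hj1 hj ht u hu1 hu2
      rcases j with _ | j
      · omega
      rcases j with _ | j
      · obtain ⟨x, hxS, hx⟩ := (H v (hv.trans hK)).2 u (by simpa using hu1) (by simpa using hu2)
        exact ⟨x, Finset.mem_insert_of_mem
          (Finset.mem_biUnion.mpr ⟨x, hxS, (hX x (K - 1)).center⟩), hx⟩
      have ht1 : ¬ IsTown (lam ^ (K - 1)) v := by simpa using ht 1 le_rfl (by omega)
      obtain ⟨y, hyS, hy⟩ := (H v (hv.trans hK)).1 ht1
      obtain ⟨x, hx, hxv⟩ := (hX y (K - 1)).hit v (by rwa [dist_comm]) (j + 1) (by omega)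
        (by omega)
        (fun i hi1 hi2 => by
          rw [hlevel]
          exact ht (i + 1) (by omega) (by omega)) u (by rwa [hlevel]) (by rwa [hlevel])
      exact ⟨x, Finset.mem_insert_of_mem (Finset.mem_biUnion.mpr ⟨y, hyS, hx⟩), hxv⟩

/-! ### Choosing the level -/

/-- For an ascending sequence of levels there is a first one at which `v` lies in a town or at
which the scale exceeds `2 * D`. -/
theorem exists_first_level {lam : ℝ} (hlam : 1 < lam) (v : V) (D : ℝ) (b : ℤ) :
    ∃ j : ℕ, (IsTown (lam ^ (b + j)) v ∨ 2 * D < lam ^ (b + j)) ∧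
      ∀ i : ℕ, i < j → ¬ IsTown (lam ^ (b + i)) v ∧ lam ^ (b + i) ≤ 2 * D := by
  classical
  have hex : ∃ j : ℕ, IsTown (lam ^ (b + j)) v ∨ 2 * D < lam ^ (b + j) := by
    obtain ⟨j, hj⟩ := pow_unbounded_of_one_lt (2 * D / lam ^ b) hlam
    refine ⟨j, Or.inr ?_⟩
    have hb : 0 < lam ^ b := zpow_pos (by linarith) _
    rw [div_lt_iff₀ hb] at hj
    rwa [zpow_add₀ (by linarith), zpow_natCast, mul_comm (lam ^ b)]
  refine ⟨Nat.find hex, Nat.find_spec hex, fun i hi => ?_⟩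
  have := Nat.find_min hex hi
  push Not at this
  exact this

/-- For points `v` and `u` at distance at most `2 * D` there is a level `K`, with scale between
`e * D / 2` and `4 * D`, at which `v` is in a town or the scale exceeds `2 * D`, and such that every
net of level `K` around `v` has a point that makes the detour from `v` to `u` at most
`4 * e * D`. -/
theorem exists_level_with_short_detour {lam e D : ℝ} (hlam : 1 < lam) (hlam2 : lam ≤ 2)
    (he : 0 < e) (he1 : e ≤ 1) (hD : 0 < D) {n : ℕ} (hn : 4 / e < lam ^ n) (v u : V)
    (hvu : dist v u ≤ 2 * D) :
    ∃ K : ℤ, (IsTown (lam ^ K) v ∨ 2 * D < lam ^ K) ∧ e * D / 2 ≤ lam ^ K ∧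
      lam ^ K ≤ 4 * D ∧ dist v u < lam ^ K ∧
      ∀ (h : V) (X : Finset V), IsNet lam h K (n + 1) X → dist h v ≤ 2 * lam ^ K →
        ∃ x ∈ X, dist v x + dist x u ≤ dist v u + 4 * e * D ∧
          (dist v x < lam ^ K ∨ lam ^ K ≤ 2 * (e * D)) := by
  have h0 : (0 : ℝ) < lam := by linarith
  have hpos : ∀ k : ℤ, 0 < lam ^ k := fun k => zpow_pos h0 k
  have hsucc : ∀ k : ℤ, lam ^ (k + 1) = lam * lam ^ k := fun k => by
    rw [zpow_add_one₀ h0.ne', mul_comm]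
  have hsucc2 : ∀ k : ℤ, lam ^ (k + 1) ≤ 2 * lam ^ k := fun k => by
    rw [hsucc]; exact mul_le_mul_of_nonneg_right hlam2 (hpos k).le
  have hmono : ∀ {k l : ℤ}, k ≤ l → lam ^ k ≤ lam ^ l := fun h => zpow_le_zpow_right₀ hlam.le h
  have heD : 0 < e * D := mul_pos he hD
  have heD1 : e * D ≤ D := by nlinarith
  obtain ⟨k₁, hk₁, hk₁'⟩ := exists_mem_Ico_zpow heD hlam
  have hk₁2 : e * D < 2 * lam ^ k₁ := hk₁'.trans_le (hsucc2 _)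
  -- the number of levels is bounded by `n`, and the scale at the last one by `4 * D`
  have hbound : ∀ (b : ℤ) (j : ℕ), k₁ ≤ b → lam ^ b ≤ 4 * D →
      (∀ i : ℕ, i < j → ¬ IsTown (lam ^ (b + i)) v ∧ lam ^ (b + i) ≤ 2 * D) →
      j ≤ n ∧ lam ^ (b + j) ≤ 4 * D := by
    intro b j hb hb4 hj
    rcases j with _ | j
    · simpa using hb4
    have hj' := (hj j (by omega)).2
    constructor
    · by_contra hcon
      have hnj : lam ^ n ≤ lam ^ j := pow_le_pow_right₀ hlam.le (by omega)
      rw [zpow_add₀ h0.ne', zpow_natCast] at hj'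
      have h1 : e * D < 2 * lam ^ b := hk₁2.trans_le (by linarith [hmono hb])
      rw [div_lt_iff₀ he] at hn
      have h2 : 4 < lam ^ j * e := hn.trans_le (mul_le_mul_of_nonneg_right hnj he.le)
      have h3 : 4 * D < 2 * (lam ^ b * lam ^ j) := by
        calc 4 * D < lam ^ j * e * D := mul_lt_mul_of_pos_right h2 hD
          _ = lam ^ j * (e * D) := by ring
          _ ≤ lam ^ j * (2 * lam ^ b) := mul_le_mul_of_nonneg_left h1.le (by positivity)
          _ = 2 * (lam ^ b * lam ^ j) := by ring
      linarith
    · have : b + ((j + 1 : ℕ) : ℤ) = b + j + 1 := by push_cast; ring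
      rw [this]
      linarith [hsucc2 (b + j)]
  -- `v` and `u` are so close that a net point near `v` is enough; otherwise a net point on a
  -- geodesic between them is used
  by_cases hnear : dist v u < lam ^ k₁
  · obtain ⟨j, hj, hj'⟩ := exists_first_level hlam v D k₁
    obtain ⟨hjn, hj4⟩ := hbound k₁ j le_rfl (by linarith) hj'
    have hkK := hmono (show k₁ ≤ k₁ + j by omega)
    refine ⟨k₁ + j, hj, by linarith, hj4, hnear.trans_le hkK, fun h X hX hhv => ?_⟩
    obtain ⟨x, hx, hxv⟩ := hX.close v hhv j (by omega) fun i hi1 hi2 => by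
      have := (hj' (j - i) (by omega)).1
      rwa [show k₁ + (j : ℤ) - i = k₁ + ((j - i : ℕ) : ℤ) by omega]
    rw [add_sub_cancel_right] at hxv
    refine ⟨x, hx, ?_, ?_⟩
    · have := dist_triangle x v u
      rw [dist_comm x v] at this
      linarith
    · by_cases h2 : 2 * lam ^ k₁ < lam ^ (k₁ + (j : ℤ))
      · exact Or.inl (hxv.trans_lt h2)
      · exact Or.inr (by linarith)
  · rw [not_lt] at hnear
    obtain ⟨k, hk, hk'⟩ := exists_mem_Ico_zpow ((hpos k₁).trans_le hnear) hlam
    have hk₁k : k₁ ≤ k := by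
      have := (zpow_lt_zpow_iff_right₀ hlam).mp (hnear.trans_lt hk')
      omega
    obtain ⟨j, hj, hj'⟩ := exists_first_level hlam v D (k + 1)
    obtain ⟨hjn, hj4⟩ := hbound (k + 1) j (by omega) (by linarith [hsucc2 k]) hj'
    have hkK := hmono (show k + 1 ≤ k + 1 + j by omega)
    have hkk := hmono (show k₁ ≤ k + 1 by omega)
    refine ⟨k + 1 + j, hj, by linarith, hj4, hk'.trans_le hkK, fun h X hX hhv => ?_⟩
    have hlev : k + 1 + (j : ℤ) - ((j + 1 : ℕ) : ℤ) = k := by push_cast; ring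
    obtain ⟨x, hx, hxv⟩ := hX.hit v hhv (j + 1) (by omega) (by omega)
      (fun i hi1 hi2 => by
        have := (hj' (j - i) (by omega)).1
        rwa [show k + 1 + (j : ℤ) - i = k + 1 + ((j - i : ℕ) : ℤ) by omega]) u
      (by rwa [hlev]) (by rw [hlev]; linarith [hsucc2 k])
    refine ⟨x, hx, by nlinarith, Or.inl ?_⟩
    have := dist_nonneg (x := x) (y := u)
    linarith

/-! ### The bags -/

/-- A representative of an open ball; it depends on the ball only as a set, so all points of a town
share it. -/
noncomputable def ballRep (r : ℝ) (v : V) : V :=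
  @Classical.epsilon V ⟨v⟩ (fun x => x ∈ Metric.ball v r)

theorem dist_ballRep_lt {r : ℝ} (hr : 0 < r) (v : V) : dist v (ballRep r v) < r := by
  have : ballRep r v ∈ Metric.ball v r :=
    Classical.epsilon_spec (p := fun x => x ∈ Metric.ball v r) ⟨v, Metric.mem_ball_self hr⟩
  rwa [dist_comm]

theorem IsTown.ballRep_eq {r : ℝ} {v x : V} (h : IsTown r v) (hx : dist v x < r) :
    ballRep r x = ballRep r v := by
  unfold ballRep
  rw [h.ball_eq hx]

variable (s : V) (lam e : ℝ) (X : V → ℤ → Finset V)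

/-- A town of level `k` around `u` that matters: it avoids the root `s`, and its scale is not much
smaller than its distance to `s`. -/
def IsRootedTown (k : ℤ) (u : V) : Prop :=
  IsTown (lam ^ k) u ∧ lam ^ k ≤ dist s u ∧ e / 4 * dist s (ballRep (lam ^ k) u) ≤ lam ^ k

/-- `x` belongs to the net of its own town of level `k`. -/
def IsTownHub (k : ℤ) (x : V) : Prop :=
  IsRootedTown s lam e k x ∧ x ∈ X (ballRep (lam ^ k) x) k

/-- `w` is `u` or shares a rooted town with it. -/
def IsNear (u w : V) : Prop :=
  w = u ∨ ∃ k, IsRootedTown s lam e k u ∧ dist u w < lam ^ k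

/-- `x` belongs to the net around the root of a level whose scale is comparable to the distance
from `s` to `x`. -/
def IsRootHub (x : V) : Prop :=
  0 < dist s x ∧ ∃ k, x ∈ X s k ∧ e / 4 * lam ^ k ≤ dist s x ∧ dist s x ≤ 6 * lam ^ k

/-- The bag of `u`: the point `u`, the root, the root hubs at a distance from `s` comparable to that
of `u`, and, unless `u` is itself a root hub, the hubs of the rooted towns of `u`. The root hubs are
eliminated last, by increasing distance from `s`, so the bag of a root hub holds only root hubs
farther out. For the other points comparability may be witnessed by any point of a
common town; this makes the condition the same throughout the town. -/
def InBag (u x : V) : Prop :=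
  x = u ∨ x = s ∨
  (¬ IsRootHub s lam e X u ∧ IsRootHub s lam e X x ∧
    ∃ w, IsNear s lam e u w ∧ dist s w ≤ 4 / e * dist s x ∧ dist s x ≤ 4 / e * dist s w) ∨
  (IsRootHub s lam e X u ∧ IsRootHub s lam e X x ∧ dist s u ≤ dist s x ∧
    dist s x ≤ 2 * (4 / e) ^ 2 * dist s u) ∨
  (¬ IsRootHub s lam e X u ∧ ¬ IsRootHub s lam e X x ∧
    ∃ k, IsTownHub s lam e X k x ∧ dist u x < lam ^ k)

/-- The highest level at which `x` is a town hub. -/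
noncomputable def hubLevel (x : V) : ℤ := sSup {k | IsTownHub s lam e X k x}

open Classical in
/-- The position in the elimination order: first the points that are no hubs, then the town hubs by
their highest level, then the root hubs by their distance from `s`, then `s`. -/
noncomputable def elimKey (x : V) : ℕ ×ₗ ℝ :=
  if x = s then toLex (3, 0)
  else if IsRootHub s lam e X x then toLex (2, dist s x)
  else if ∃ k, IsTownHub s lam e X k x then toLex (1, (hubLevel s lam e X x : ℝ))
  else toLex (0, 0)

variable {s lam e X}

theorem IsRootedTown.of_dist_lt {k : ℤ} {u x : V} (h : IsRootedTown s lam e k u)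
    (hx : dist u x < lam ^ k) : IsRootedTown s lam e k x := by
  refine ⟨h.1.of_dist_lt hx, ?_, ?_⟩
  · by_contra hcon
    have : dist u s < lam ^ k := by
      rw [h.1 x s hx, dist_comm]
      exact not_le.mp hcon
    rw [dist_comm] at this
    linarith [h.2.1]
  · rw [h.1.ballRep_eq hx]
    exact h.2.2

theorem IsNear.symm {u w : V} (h : IsNear s lam e u w) : IsNear s lam e w u := by
  rcases h with h | ⟨k, hk, hd⟩
  · exact Or.inl h.symm
  · exact Or.inr ⟨k, hk.of_dist_lt hd, by rwa [dist_comm]⟩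

theorem IsNear.trans (hlam : 1 < lam) {u w z : V} (h : IsNear s lam e u w)
    (h' : IsNear s lam e w z) : IsNear s lam e u z := by
  rcases h with rfl | ⟨k, hk, hd⟩
  · exact h'
  rcases h' with rfl | ⟨l, hl, hd'⟩
  · exact Or.inr ⟨k, hk, hd⟩
  rcases le_total k l with hkl | hkl
  · have hd2 : dist u w < lam ^ l := hd.trans_le (zpow_le_zpow_right₀ hlam.le hkl)
    rw [dist_comm] at hd2
    exact Or.inr ⟨l, hl.of_dist_lt hd2, (hl.1 u z hd2).mp hd'⟩
  · have hd2 : dist w z < lam ^ k := hd'.trans_le (zpow_le_zpow_right₀ hlam.le hkl)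
    exact Or.inr ⟨k, hk, (hk.1 w z hd).mpr hd2⟩

theorem IsNear.dist_le {u w : V} (h : IsNear s lam e u w) : dist s w ≤ 2 * dist s u := by
  rcases h with rfl | ⟨k, hk, hd⟩
  · linarith [dist_nonneg (x := s) (y := w)]
  · linarith [dist_triangle s u w, hk.2.1]

theorem IsTownHub.ne_root (hlam : 0 < lam) {k : ℤ} {x : V} (h : IsTownHub s lam e X k x) :
    x ≠ s := by
  rintro rfl
  have h1 := h.1.2.1
  rw [dist_self] at h1
  exact absurd (zpow_pos hlam k) (not_lt.mpr h1)

theorem IsRootHub.ne_root {x : V} (h : IsRootHub s lam e X x) : x ≠ s := by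
  rintro rfl
  simpa using h.1

theorem bddAbove_isTownHub (hlam : 1 < lam) (x : V) :
    BddAbove {k | IsTownHub s lam e X k x} := by
  obtain ⟨n, hn⟩ := pow_unbounded_of_one_lt (dist s x) hlam
  refine ⟨n, fun k hk => ?_⟩
  have h1 : lam ^ k < lam ^ (n : ℤ) := by
    rw [zpow_natCast]
    exact hk.1.2.1.trans_lt hn
  exact ((zpow_lt_zpow_iff_right₀ hlam).mp h1).le

theorem IsTownHub.hubLevel (hlam : 1 < lam) {k : ℤ} {x : V} (h : IsTownHub s lam e X k x) :
    IsTownHub s lam e X (hubLevel s lam e X x) x ∧ k ≤ hubLevel s lam e X x :=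
  ⟨Int.csSup_mem (s := {k | IsTownHub s lam e X k x}) ⟨k, h⟩ (bddAbove_isTownHub hlam x),
    le_csSup (bddAbove_isTownHub hlam x) h⟩

theorem eq_root_of_elimKey_le {y : V} (h : elimKey s lam e X s ≤ elimKey s lam e X y) :
    y = s := by
  by_contra hy
  unfold elimKey at h
  rw [if_pos rfl, if_neg hy] at h
  split_ifs at h <;> rw [Prod.Lex.toLex_le_toLex] at h <;> norm_num at h

theorem IsRootHub.of_elimKey_le {x y : V} (hx : IsRootHub s lam e X x)
    (h : elimKey s lam e X x ≤ elimKey s lam e X y) (hy : y ≠ s) :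
    IsRootHub s lam e X y ∧ dist s x ≤ dist s y := by
  unfold elimKey at h
  rw [if_neg hx.ne_root, if_pos hx, if_neg hy] at h
  split_ifs at h with h1 <;> rw [Prod.Lex.toLex_le_toLex] at h <;> norm_num at h
  exact ⟨h1, h⟩

theorem IsTownHub.of_elimKey_le (hlam : 1 < lam) {k : ℤ} {x y : V}
    (hx : IsTownHub s lam e X k x) (hx' : ¬ IsRootHub s lam e X x)
    (h : elimKey s lam e X x ≤ elimKey s lam e X y) (hy : y ≠ s)
    (hy' : ¬ IsRootHub s lam e X y) :
    ∃ l, k ≤ l ∧ IsTownHub s lam e X l y ∧ ∀ j, IsTownHub s lam e X j y → j ≤ l := by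
  unfold elimKey at h
  rw [if_neg (hx.ne_root (by linarith)), if_neg hx', if_pos ⟨k, hx⟩, if_neg hy, if_neg hy'] at h
  split_ifs at h with h1 <;> rw [Prod.Lex.toLex_le_toLex] at h <;> norm_num at h
  obtain ⟨l, hl⟩ := h1
  exact ⟨_, (hx.hubLevel hlam).2.trans h, (hl.hubLevel hlam).1, fun j hj => (hj.hubLevel hlam).2⟩

/-- Of two members of a bag, the one eliminated later is in the bag of the other. -/
theorem inBag_closed (hlam : 1 < lam) (he : 0 < e) (he1 : e ≤ 1) (u x y : V)
    (hx : InBag s lam e X u x) (hy : InBag s lam e X u y)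
    (h : elimKey s lam e X x ≤ elimKey s lam e X y) : InBag s lam e X x y := by
  have hA : 4 ≤ 4 / e := by rw [le_div_iff₀ he]; linarith
  have hA2 : 1 ≤ 2 * (4 / e) ^ 2 := by nlinarith
  by_cases hys : y = s
  · exact Or.inr (Or.inl hys)
  by_cases hxs : x = s
  · rw [hxs] at h
    exact absurd (eq_root_of_elimKey_le h) hys
  by_cases hxu : x = u
  · rwa [hxu]
  by_cases hP : IsRootHub s lam e X x
  · obtain ⟨hyP, hxy⟩ := hP.of_elimKey_le h hys
    refine Or.inr (Or.inr (Or.inr (Or.inl ⟨hP, hyP, hxy, ?_⟩)))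
    rcases hx with hx | hx | ⟨huP, -, w, hw, hw1, hw2⟩ | ⟨huP, -, hux, hux'⟩ | ⟨-, hx, -⟩
    · exact absurd hx hxu
    · exact absurd hx hxs
    · rcases hy with hy | hy | ⟨-, -, w', hw', hw1', hw2'⟩ | ⟨hy, -⟩ | ⟨-, hy, -⟩
      · exact absurd (hy ▸ hyP) huP
      · exact absurd hy hys
      · have h1 : dist s w' ≤ 2 * dist s w := (hw.symm.trans hlam hw').dist_le
        calc dist s y ≤ 4 / e * dist s w' := hw2'
          _ ≤ 4 / e * (2 * (4 / e * dist s x)) := by gcongr; linarith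
          _ = _ := by ring
      · exact absurd hy huP
      · exact absurd hyP hy
    · rcases hy with hy | hy | ⟨hy, -⟩ | ⟨-, -, huy, huy'⟩ | ⟨hy, -⟩
      · have := hP.1
        rw [hy]
        nlinarith
      · exact absurd hy hys
      · exact absurd huP hy
      · exact huy'.trans (by gcongr)
      · exact absurd huP hy
    · exact absurd hP hx
  · rcases hx with hx | hx | ⟨-, hx, -⟩ | ⟨-, hx, -⟩ | ⟨huP, -, k, hk, hux⟩
    · exact absurd hx hxu
    · exact absurd hx hxs
    · exact absurd hx hP
    · exact absurd hx hP
    by_cases hyP : IsRootHub s lam e X y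
    · rcases hy with hy | hy | ⟨-, -, w', hw', hw1', hw2'⟩ | ⟨hy, -⟩ | ⟨-, hy, -⟩
      · exact absurd (hy ▸ hyP) huP
      · exact absurd hy hys
      · refine Or.inr (Or.inr (Or.inl ⟨hP, hyP, w', IsNear.trans hlam (Or.inr ⟨k, hk.1, ?_⟩) hw',
          hw1', hw2'⟩))
        rwa [dist_comm]
      · exact absurd hy huP
      · exact absurd hyP hy
    · obtain ⟨l, hkl, hl, hmax⟩ := hk.of_elimKey_le hlam hP h hys hyP
      have huy : dist u y < lam ^ l := by
        rcases hy with hy | hy | ⟨-, hy, -⟩ | ⟨hy, -⟩ | ⟨-, -, j, hj, huy⟩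
        · rw [hy, dist_self]
          exact zpow_pos (by linarith) _
        · exact absurd hy hys
        · exact absurd hy hyP
        · exact absurd hy huP
        · exact huy.trans_le (zpow_le_zpow_right₀ hlam.le (hmax j hj))
      have hux' : dist u x < lam ^ l := hux.trans_le (zpow_le_zpow_right₀ hlam.le hkl)
      refine Or.inr (Or.inr (Or.inr (Or.inr ⟨hP, hyP, l, hl, ?_⟩)))
      rw [dist_comm] at huy ⊢
      exact (hl.1.1 u x huy).mpr hux'

theorem IsTownHub.inBag (he : 0 < e) (he1 : e ≤ 1) {k : ℤ} {u x : V}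
    (h : IsTownHub s lam e X k x) (hux : dist u x < lam ^ k) :
    InBag s lam e X u x ∨ InBag s lam e X x u := by
  have hA : 4 ≤ 4 / e := by rw [le_div_iff₀ he]; linarith
  have hxu : IsNear s lam e x u := Or.inr ⟨k, h.1, by rwa [dist_comm]⟩
  have hA2 : 2 ≤ 2 * (4 / e) ^ 2 := by nlinarith
  have h1 := hxu.dist_le
  have h2 := hxu.symm.dist_le
  have h3 := dist_nonneg (x := s) (y := u)
  have h4 := dist_nonneg (x := s) (y := x)
  by_cases hu : IsRootHub s lam e X u <;> by_cases hx : IsRootHub s lam e X x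
  · rcases le_total (dist s u) (dist s x) with hle | hle
    · exact Or.inl (Or.inr (Or.inr (Or.inr (Or.inl ⟨hu, hx, hle,
        h2.trans (mul_le_mul_of_nonneg_right hA2 h3)⟩))))
    · exact Or.inr (Or.inr (Or.inr (Or.inr (Or.inl ⟨hx, hu, hle,
        h1.trans (mul_le_mul_of_nonneg_right hA2 h4)⟩))))
  · exact Or.inr (Or.inr (Or.inr (Or.inl ⟨hx, hu, u, hxu, by nlinarith, by nlinarith⟩)))
  · exact Or.inl (Or.inr (Or.inr (Or.inl ⟨hu, hx, x, hxu.symm, by nlinarith, by nlinarith⟩)))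
  · exact Or.inl (Or.inr (Or.inr (Or.inr (Or.inr ⟨hu, hx, k, h, hux⟩))))

theorem IsRootHub.inBag (he : 0 < e) (he1 : e ≤ 1) {u x : V} (hx : IsRootHub s lam e X x)
    (h1 : dist s u ≤ 4 / e * dist s x) (h2 : dist s x ≤ 4 / e * dist s u) :
    InBag s lam e X u x ∨ InBag s lam e X x u := by
  have hA : 4 ≤ 4 / e := by rw [le_div_iff₀ he]; linarith
  have hAA : 4 / e ≤ 2 * (4 / e) ^ 2 := by nlinarith
  have h3 := dist_nonneg (x := s) (y := u)
  have h4 := dist_nonneg (x := s) (y := x)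
  by_cases hu : IsRootHub s lam e X u
  · rcases le_total (dist s u) (dist s x) with hle | hle
    · exact Or.inl (Or.inr (Or.inr (Or.inr (Or.inl ⟨hu, hx, hle,
        h2.trans (mul_le_mul_of_nonneg_right hAA h3)⟩))))
    · exact Or.inr (Or.inr (Or.inr (Or.inr (Or.inl ⟨hx, hu, hle,
        h1.trans (mul_le_mul_of_nonneg_right hAA h4)⟩))))
  · exact Or.inl (Or.inr (Or.inr (Or.inl ⟨hu, hx, u, Or.inl rfl, h1, h2⟩)))

/-! ### The size of the bags -/

/-- The powers of `lam` in a window of bounded ratio have boundedly many exponents. -/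
theorem exists_zpow_window {lam p q : ℝ} (hlam : 1 < lam) (hp : 0 < p) {m : ℕ}
    (hm : q ≤ lam ^ m) :
    ∃ k₀ : ℤ, ∀ k : ℤ, p ≤ lam ^ k → lam ^ k ≤ q * p → k ∈ Finset.Icc k₀ (k₀ + m) := by
  have h0 : (0 : ℝ) < lam := by linarith
  obtain ⟨n, hn, hn'⟩ := exists_mem_Ico_zpow hp hlam
  refine ⟨n, fun k hk hk' => ?_⟩
  rw [Finset.mem_Icc]
  constructor
  · exact (zpow_le_zpow_iff_right₀ hlam).mp (hn.trans hk)
  · have h1 : lam ^ k < lam ^ ((m : ℤ) + (n + 1)) := by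
      rw [zpow_add₀ h0.ne', zpow_natCast]
      calc lam ^ k ≤ q * p := hk'
        _ ≤ lam ^ m * p := mul_le_mul_of_nonneg_right hm hp.le
        _ < lam ^ m * lam ^ (n + 1) := mul_lt_mul_of_pos_left hn' (pow_pos h0 m)
    have := (zpow_lt_zpow_iff_right₀ hlam).mp h1
    omega

/-- Bags are bounded: only boundedly many levels contribute to a bag, each with one net. -/
theorem ncard_inBag_le (hlam : 1 < lam) (he : 0 < e) (he1 : e ≤ 1) {M m : ℕ}
    (hX : ∀ h k, (X h k).card ≤ M) (hm : 96 * (4 / e) ^ 5 ≤ lam ^ m) (u : V) :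
    {x | InBag s lam e X u x}.ncard ≤ 2 + 2 * ((m + 1) * M) := by
  classical
  have hA : 4 ≤ 4 / e := by rw [le_div_iff₀ he]; linarith
  set A := 4 / e with hAdef
  have heA : e / 4 = A⁻¹ := by rw [hAdef, inv_div]
  have hApos : 0 < A := by linarith
  rcases (dist_nonneg (x := s) (y := u)).eq_or_lt with h0 | hu
  · -- the bag of the root is `{s}`
    have hus : u = s := (dist_eq_zero.mp h0.symm).symm
    have hsub : {x | InBag s lam e X u x} ⊆ (({s} : Finset V) : Set V) := by
      intro x hx
      rw [Finset.coe_singleton, Set.mem_singleton_iff]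
      rcases hx with hx | hx | ⟨-, hx, w, hw, -, hw2⟩ | ⟨hx, -⟩ | ⟨-, -, k, hk, hux⟩
      · rw [hx, hus]
      · exact hx
      · have h1 := hw.dist_le
        have h2 := hx.1
        have : dist s w = 0 := le_antisymm (by linarith) dist_nonneg
        rw [this, mul_zero] at hw2
        linarith
      · exact absurd hus hx.ne_root
      · have h1 := hk.1.of_dist_lt (x := u) (by rwa [dist_comm])
        exact absurd (zpow_pos (show 0 < lam by linarith) k) (not_lt.mpr (h1.2.1.trans h0.symm.le))
    refine (Set.ncard_le_ncard hsub (Finset.finite_toSet _)).trans ?_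
    rw [Set.ncard_coe_finset, Finset.card_singleton]
    omega
  set D := dist s u with hDdef
  -- `k₀` starts the window of levels for the root hubs, `k₁` that for the towns of `u`; the ratio
  -- `96 * A ^ 5` is generous for both
  obtain ⟨k₀, hk₀⟩ := exists_zpow_window (p := D / (12 * A ^ 2)) (q := 96 * A ^ 5) hlam
    (by positivity) hm
  obtain ⟨k₁, hk₁⟩ := exists_zpow_window (p := D / (2 * A)) (q := 96 * A ^ 5) hlam
    (by positivity) hm
  have hwin : ∀ x, IsRootHub s lam e X x → D ≤ 2 * A ^ 2 * dist s x → dist s x ≤ 2 * A ^ 2 * D →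
      ∃ k ∈ Finset.Icc k₀ (k₀ + m), x ∈ X s k := by
    rintro x ⟨hx, k, hk, hk1, hk2⟩ h1 h2
    refine ⟨k, hk₀ k ?_ ?_, hk⟩
    · rw [div_le_iff₀ (by positivity)]
      calc D ≤ 2 * A ^ 2 * dist s x := h1
        _ ≤ 2 * A ^ 2 * (6 * lam ^ k) := mul_le_mul_of_nonneg_left hk2 (by positivity)
        _ = _ := by ring
    · rw [heA, inv_mul_le_iff₀ hApos] at hk1
      calc lam ^ k ≤ A * dist s x := hk1
        _ ≤ A * (2 * A ^ 2 * D) := mul_le_mul_of_nonneg_left h2 hApos.le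
        _ = 2 * A ^ 3 * D := by ring
        _ ≤ 8 * A ^ 3 * D := by gcongr; norm_num
        _ = 96 * A ^ 5 * (D / (12 * A ^ 2)) := by field_simp; norm_num
  let F : Finset V := {u, s} ∪ ((Finset.Icc k₀ (k₀ + m)).biUnion (fun k => X s k) ∪
    (Finset.Icc k₁ (k₁ + m)).biUnion (fun k => X (ballRep (lam ^ k) u) k))
  have hsub : {x | InBag s lam e X u x} ⊆ (F : Set V) := by
    intro x hx
    simp only [F, Finset.mem_coe, Finset.mem_union, Finset.mem_biUnion, Finset.mem_insert,
      Finset.mem_singleton]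
    rcases hx with hx | hx | ⟨-, hx, w, hw, hw1, hw2⟩ | ⟨-, hx, h1, h2⟩ | ⟨-, -, k, hk, hux⟩
    · exact Or.inl (Or.inl hx)
    · exact Or.inl (Or.inr hx)
    · have h1 := hw.dist_le
      have h2 := hw.symm.dist_le
      refine Or.inr (Or.inl (hwin x hx ?_ ?_))
      · have := hx.1
        nlinarith
      · calc dist s x ≤ A * dist s w := hw2
          _ ≤ A * (2 * D) := mul_le_mul_of_nonneg_left h1 hApos.le
          _ = 2 * A * D := by ring
          _ ≤ 2 * A ^ 2 * D := by gcongr; nlinarith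
    · refine Or.inr (Or.inl (hwin x hx ?_ h2))
      have := hx.1
      nlinarith
    · have hux' : dist x u < lam ^ k := by rwa [dist_comm]
      have hku := hk.1.of_dist_lt hux'
      have hkpos : 0 < lam ^ k := zpow_pos (by linarith) k
      refine Or.inr (Or.inr ⟨k, hk₁ k ?_ ?_, ?_⟩)
      · have h1 : IsNear s lam e u (ballRep (lam ^ k) u) :=
          Or.inr ⟨k, hku, dist_ballRep_lt hkpos u⟩
        have h2 := h1.symm.dist_le
        have h3 := hku.2.2
        rw [heA, inv_mul_le_iff₀ hApos] at h3
        rw [div_le_iff₀ (by positivity)]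
        linarith
      · calc lam ^ k ≤ D := hku.2.1
          _ ≤ 48 * A ^ 4 * D := by
              have : 1 ≤ 48 * A ^ 4 := by
                have := one_le_pow₀ (show 1 ≤ A by linarith) (n := 4)
                linarith
              nlinarith
          _ = 96 * A ^ 5 * (D / (2 * A)) := by field_simp; norm_num
      · rw [hk.1.1.ballRep_eq hux']
        exact hk.2
  refine (Set.ncard_le_ncard hsub (Finset.finite_toSet _)).trans ?_
  rw [Set.ncard_coe_finset]
  have hI : ∀ k : ℤ, (Finset.Icc k (k + m)).card = m + 1 := fun k => by
    rw [Int.card_Icc]; omega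
  have c0 : ({u, s} : Finset V).card ≤ 2 := Finset.card_le_two
  have c1 := Finset.card_biUnion_le_card_mul (Finset.Icc k₀ (k₀ + m)) (fun k => X s k) M
    (fun k _ => hX _ _)
  have c2 := Finset.card_biUnion_le_card_mul (Finset.Icc k₁ (k₁ + m))
    (fun k => X (ballRep (lam ^ k) u) k) M (fun k _ => hX _ _)
  rw [hI] at c1 c2
  refine (Finset.card_union_le _ _).trans ?_
  have c3 := Finset.card_union_le ((Finset.Icc k₀ (k₀ + m)).biUnion (fun k => X s k))
    ((Finset.Icc k₁ (k₁ + m)).biUnion (fun k => X (ballRep (lam ^ k) u) k))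
  omega

/-! ### Short detours -/

/-- Two points, the farther of which from `s` is `v`, are joined by a short detour over a point that
shares a bag with each of them. -/
theorem exists_common_neighbour_of_le (hlam : 1 < lam) (hlam2 : lam ≤ 2) (he : 0 < e)
    (he1 : e ≤ 1 / 4) {n : ℕ} (hn : 4 / e < lam ^ n)
    (hX : ∀ h k, IsNet lam h k (n + 1) (X h k)) (u v : V) (huv : dist s u ≤ dist s v) :
    ∃ x, (InBag s lam e X u x ∨ InBag s lam e X x u) ∧
      (InBag s lam e X v x ∨ InBag s lam e X x v) ∧
      dist v x + dist x u ≤ dist v u + 6 * e * dist s v := by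
  have hlevpos : ∀ k : ℤ, 0 < lam ^ k := fun k => zpow_pos (by linarith) k
  set D := dist s v with hDdef
  have hD0 : 0 ≤ D := dist_nonneg
  have hvs : dist v s = D := dist_comm _ _
  have hus : dist u s = dist s u := dist_comm _ _
  -- points close to the root are served by the root
  have hroot : ∀ y, dist v y + dist y u ≤ dist v u + 4 * e * D → dist s y ≤ e * D →
      dist v s + dist s u ≤ dist v u + 6 * e * D := fun y h1 h2 => by
    have t1 := dist_triangle v y s
    have t2 := dist_triangle s y u
    rw [dist_comm y s] at t1
    linarith
  by_cases hu : dist s u ≤ e * D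
  · refine ⟨s, Or.inl (Or.inr (Or.inl rfl)), Or.inl (Or.inr (Or.inl rfl)), hroot u ?_ hu⟩
    rw [dist_self]
    have := mul_nonneg he.le hD0
    linarith
  rw [not_le] at hu
  have hD : 0 < D := by
    by_contra hcon
    have : D = 0 := le_antisymm (not_lt.mp hcon) hD0
    rw [this] at hu huv
    linarith
  have hvu : dist v u ≤ 2 * D := by
    have := dist_triangle v s u
    linarith
  obtain ⟨K, hK, hKe, hK4, hKd, hnet⟩ :=
    exists_level_with_short_detour hlam hlam2 he (by linarith) hD hn v u hvu
  by_cases hT : IsTown (lam ^ K) v ∧ lam ^ K ≤ D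
  · -- the town of `v` contains `u` as well, and its net serves both
    obtain ⟨hT, hKD⟩ := hT
    set h := ballRep (lam ^ K) v with hh
    have hvh : dist v h < lam ^ K := dist_ballRep_lt (hlevpos K) v
    have hhD : e / 4 * dist s h ≤ lam ^ K := by
      have t := dist_triangle s v h
      have : dist s h ≤ 2 * D := by linarith
      nlinarith
    have hvT : IsRootedTown s lam e K v := ⟨hT, hKD, hhD⟩
    obtain ⟨x, hx, hxd, hxv⟩ : ∃ x ∈ X h K, dist v x + dist x u ≤ dist v u + 4 * e * D ∧
        dist v x < lam ^ K := by
      obtain ⟨x, hx, hxd, hxv | hxv⟩ := hnet h (X h K) (hX h K) (by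
        rw [dist_comm]; linarith [hlevpos K])
      · exact ⟨x, hx, hxd, hxv⟩
      · -- the town is so small that its representative is close enough to `v`
        refine ⟨h, (hX h K).center, ?_, hvh⟩
        have t := dist_triangle h v u
        rw [dist_comm h v] at t
        linarith
    have hhub : IsTownHub s lam e X K x := by
      refine ⟨hvT.of_dist_lt hxv, ?_⟩
      rw [hT.ballRep_eq hxv]
      exact hx
    refine ⟨x, hhub.inBag he (by linarith) ?_, hhub.inBag he (by linarith) hxv, ?_⟩
    · rw [dist_comm]
      exact (hT x u hxv).mp hKd
    · have := mul_nonneg he.le hD0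
      linarith
  · -- there is no rooted town at this level, so `v` is in reach of the net around `s`
    have hDK : D < lam ^ K := by
      rcases hK with hK | hK
      · exact not_le.mp fun hle => hT ⟨hK, hle⟩
      · linarith
    obtain ⟨x, hx, hxd, -⟩ := hnet s (X s K) (hX s K) (by rw [← hDdef]; linarith)
    by_cases hxs : dist s x ≤ e * D
    · exact ⟨s, Or.inl (Or.inr (Or.inl rfl)), Or.inl (Or.inr (Or.inl rfl)), hroot x hxd hxs⟩
    rw [not_le] at hxs
    have heD : e * D ≤ D / 4 := by nlinarith
    have heD0 : 0 < e * D := mul_pos he hD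
    have hx4 : dist s x ≤ 4 * D := by
      have t := dist_triangle s v x
      have := dist_nonneg (x := x) (y := u)
      linarith
    have hP : IsRootHub s lam e X x := by
      refine ⟨by linarith, K, hx, ?_, by linarith⟩
      have : e / 4 * lam ^ K ≤ e / 4 * (4 * D) := mul_le_mul_of_nonneg_left hK4 (by positivity)
      linarith
    have hquot : ∀ a b : ℝ, e * a ≤ 4 * b → a ≤ 4 / e * b := fun a b hab => by
      rw [div_mul_eq_mul_div, le_div_iff₀ he]
      linarith
    refine ⟨x, hP.inBag he (by linarith) (hquot _ _ ?_) (hquot _ _ ?_),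
      hP.inBag he (by linarith) (hquot _ _ ?_) (hquot _ _ ?_), by linarith⟩
    · nlinarith
    · nlinarith
    · linarith
    · nlinarith

/-- The metric form of the theorem: a perfect elimination scheme with bounded bags such that any two
points are joined by a short detour over a point that shares a bag with each of them. -/
theorem exists_elimination_scheme {c : ℝ} (hc : 4 < c) {ε : ℝ} (hε : 0 < ε) (η : ℕ) :
    ∃ w : ℕ, ∀ (W : Type*) [MetricSpace W] (s : W), HasMetricHubs W c η →
      ∃ (R : W → W → Prop) (key : W → ℕ ×ₗ ℝ), (∀ u, R u u) ∧
        (∀ u x y, R u x → R u y → key x ≤ key y → R x y) ∧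
        (∀ u, {x | R u x}.ncard ≤ w + 1) ∧
        ∀ u v, ∃ x, (R u x ∨ R x u) ∧ (R v x ∨ R x v) ∧
          dist u x + dist x v ≤ dist u v + ε * (dist s u + dist s v) := by
  -- `(c - 2) / 2` makes the radii of consecutive nets match; the bound `2` keeps a geodesic whose
  -- length lies between consecutive scales within the reach of a net
  set lam := min ((c - 2) / 2) 2 with hlamdef
  have hlam : 1 < lam := lt_min (by linarith) (by norm_num)
  have hlam2 : lam ≤ 2 := min_le_right _ _
  have hlamc : 2 * lam ≤ c - 2 := by
    have := min_le_left ((c - 2) / 2) 2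
    linarith
  set e := min (1 / 4) (ε / 6) with hedef
  have he : 0 < e := lt_min (by norm_num) (by linarith)
  have he1 : e ≤ 1 / 4 := min_le_left _ _
  have heε : 6 * e ≤ ε := by
    have := min_le_right (1 / 4) (ε / 6)
    linarith
  obtain ⟨n, hn⟩ := pow_unbounded_of_one_lt (4 / e) hlam
  obtain ⟨m, hm⟩ := pow_unbounded_of_one_lt (96 * (4 / e) ^ 5) hlam
  refine ⟨1 + 2 * ((m + 1) * netCard η (n + 1)), fun W _ s hub => ?_⟩
  choose X hXc hX using exists_isNet hub (show 0 < lam by linarith) hlamc (n + 1)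
  refine ⟨InBag s lam e X, elimKey s lam e X, fun u => Or.inl rfl,
    inBag_closed hlam he (by linarith),
    fun u => (ncard_inBag_le hlam he (by linarith) hXc hm.le u).trans (by omega),
    fun u v => ?_⟩
  have hu0 := dist_nonneg (x := s) (y := u)
  have hv0 := dist_nonneg (x := s) (y := v)
  rcases le_total (dist s u) (dist s v) with h | h
  · obtain ⟨x, h1, h2, h3⟩ := exists_common_neighbour_of_le hlam hlam2 he he1 hn hX u v h
    refine ⟨x, h1, h2, ?_⟩
    rw [dist_comm v x, dist_comm x u, dist_comm v u] at h3
    nlinarith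
  · obtain ⟨x, h1, h2, h3⟩ := exists_common_neighbour_of_le hlam hlam2 he he1 hn hX v u h
    refine ⟨x, h2, h1, ?_⟩
    nlinarith

end Metric

/-! ### The metric of a graph with edge lengths -/

namespace LengthGraph

variable {V : Type*} (G : LengthGraph V)

theorem walkLength_cons {u v w : V} (h : G.graph.Adj u v) (p : G.graph.Walk v w) :
    G.walkLength (.cons h p) = G.len s(u, v) + G.walkLength p := by
  simp [walkLength]

theorem walkLength_append {u v w : V} (p : G.graph.Walk u v) (q : G.graph.Walk v w) :
    G.walkLength (p.append q) = G.walkLength p + G.walkLength q := by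
  simp [walkLength]

theorem walkLength_reverse {u v : V} (p : G.graph.Walk u v) :
    G.walkLength p.reverse = G.walkLength p := by
  simp [walkLength, List.sum_reverse]

theorem walkLength_nonneg {u v : V} (p : G.graph.Walk u v) : 0 ≤ G.walkLength p := by
  refine List.sum_nonneg fun x hx => ?_
  obtain ⟨e, he, rfl⟩ := List.mem_map.mp hx
  exact (G.len_pos e (p.edges_subset_edgeSet he)).le

theorem walkLength_bypass_le [DecidableEq V] {u v : V} (p : G.graph.Walk u v) :
    G.walkLength p.bypass ≤ G.walkLength p := by
  refine List.Sublist.sum_le_sum (p.edges_bypass_sublist_edges.map _) fun x hx => ?_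
  obtain ⟨e, he, rfl⟩ := List.mem_map.mp hx
  exact (G.len_pos e (p.edges_subset_edgeSet he)).le

theorem dist_le_walkLength {u v : V} (p : G.graph.Walk u v) :
    G.dist u v ≤ ENNReal.ofReal (G.walkLength p) :=
  iInf_le _ p

theorem exists_isShortestPath [Finite V] {u v : V} (h : Nonempty (G.graph.Walk u v)) :
    ∃ p : G.graph.Walk u v, G.IsShortestPath p := by
  classical
  have := Fintype.ofFinite V
  obtain ⟨p₀⟩ := h
  have : Nonempty (G.graph.Path u v) := ⟨p₀.toPath⟩
  obtain ⟨p, hp⟩ := Finite.exists_min (fun p : G.graph.Path u v => G.walkLength p.1)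
  exact ⟨p.1, fun q => (hp q.toPath).trans (G.walkLength_bypass_le q)⟩

variable {G} in
theorem IsShortestPath.dist_eq {u v : V} {p : G.graph.Walk u v} (hp : G.IsShortestPath p) :
    G.dist u v = ENNReal.ofReal (G.walkLength p) :=
  le_antisymm (G.dist_le_walkLength p) (le_iInf fun q => ENNReal.ofReal_le_ofReal (hp q))

theorem exists_isShortestPath_of_dist_ne_top [Finite V] {u v : V} (h : G.dist u v ≠ ⊤) :
    ∃ p : G.graph.Walk u v, G.IsShortestPath p := by
  refine G.exists_isShortestPath ?_
  by_contra hcon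
  rw [not_nonempty_iff] at hcon
  exact h (by unfold LengthGraph.dist; exact iInf_of_empty _)

theorem dist_self (u : V) : G.dist u u = 0 := by
  have := G.dist_le_walkLength (.nil : G.graph.Walk u u)
  simpa [walkLength] using this

theorem dist_comm (u v : V) : G.dist u v = G.dist v u := by
  have key : ∀ a b : V, G.dist a b ≤ G.dist b a := fun a b =>
    le_iInf fun p => by
      rw [← G.walkLength_reverse]
      exact G.dist_le_walkLength p.reverse
  exact le_antisymm (key u v) (key v u)

theorem dist_triangle [Finite V] (u v w : V) : G.dist u w ≤ G.dist u v + G.dist v w := by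
  by_cases h1 : G.dist u v = ⊤
  · simp [h1]
  by_cases h2 : G.dist v w = ⊤
  · simp [h2]
  obtain ⟨p, hp⟩ := G.exists_isShortestPath_of_dist_ne_top h1
  obtain ⟨q, hq⟩ := G.exists_isShortestPath_of_dist_ne_top h2
  rw [hp.dist_eq, hq.dist_eq, ← ENNReal.ofReal_add (G.walkLength_nonneg p)
    (G.walkLength_nonneg q), ← walkLength_append]
  exact G.dist_le_walkLength _

theorem eq_of_dist_eq_zero [Finite V] {u v : V} (h : G.dist u v = 0) : u = v := by
  obtain ⟨p, hp⟩ := G.exists_isShortestPath_of_dist_ne_top (u := u) (v := v) (by simp [h])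
  rw [hp.dist_eq, ENNReal.ofReal_eq_zero] at h
  cases p with
  | nil => rfl
  | cons hadj q =>
    rw [walkLength_cons] at h
    have h1 := G.len_pos _ (G.graph.mem_edgeSet.mpr hadj)
    have h2 := G.walkLength_nonneg q
    linarith

/-- The type of the vertices at finite distance from `s`. -/
structure Component (s : V) where
  val : V
  dist_root_ne_top : G.dist s val ≠ ⊤

variable {G} in
theorem Component.val_injective {s : V} : Function.Injective (Component.val (G := G) (s := s)) := by
  rintro ⟨x, hx⟩ ⟨y, hy⟩ rfl
  rfl

variable {G} in
theorem Component.dist_ne_top [Finite V] {s : V} (x y : G.Component s) :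
    G.dist x.1 y.1 ≠ ⊤ := by
  refine ne_top_of_le_ne_top (ENNReal.add_ne_top.mpr ⟨?_, y.2⟩) (G.dist_triangle x.1 s y.1)
  rw [G.dist_comm]
  exact x.2

noncomputable instance [Finite V] (s : V) : MetricSpace (G.Component s) where
  dist x y := (G.dist x.1 y.1).toReal
  dist_self x := by simp [G.dist_self]
  dist_comm x y := by rw [G.dist_comm]
  dist_triangle x y z := by
    rw [← ENNReal.toReal_add (Component.dist_ne_top x y) (Component.dist_ne_top y z)]
    exact ENNReal.toReal_mono
      (ENNReal.add_ne_top.mpr ⟨Component.dist_ne_top x y, Component.dist_ne_top y z⟩)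
      (G.dist_triangle _ _ _)
  eq_of_dist_eq_zero {x y} h := by
    rw [ENNReal.toReal_eq_zero_iff] at h
    exact Component.val_injective
      (G.eq_of_dist_eq_zero (h.resolve_right (Component.dist_ne_top x y)))

variable {G} in
theorem Component.ofReal_dist [Finite V] {s : V} (x y : G.Component s) :
    ENNReal.ofReal (Dist.dist x y) = G.dist x.1 y.1 :=
  ENNReal.ofReal_toReal (Component.dist_ne_top x y)

theorem IsShortestPath.component_dist_eq [Finite V] {s : V} {a b : G.Component s}
    {p : G.graph.Walk a.1 b.1} (hp : G.IsShortestPath p) : Dist.dist a b = G.walkLength p := by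
  change (G.dist a.1 b.1).toReal = _
  rw [hp.dist_eq, ENNReal.toReal_ofReal (G.walkLength_nonneg p)]

/-- The vertices of a shortest path lie between its ends. -/
theorem IsShortestPath.dist_add_dist [Finite V] {s : V} {a b : G.Component s}
    {p : G.graph.Walk a.1 b.1} (hp : G.IsShortestPath p) {x : V} (hx : x ∈ p.support) :
    ∃ hxs : G.dist s x ≠ ⊤,
      Dist.dist a (⟨x, hxs⟩ : G.Component s) + Dist.dist (⟨x, hxs⟩ : G.Component s) b =
        Dist.dist a b := by
  classical
  have h1 := G.dist_le_walkLength (p.takeUntil x hx)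
  have h2 := G.dist_le_walkLength (p.dropUntil x hx)
  have hsum := G.walkLength_append (p.takeUntil x hx) (p.dropUntil x hx)
  rw [p.take_spec] at hsum
  have hax : G.dist a.1 x ≠ ⊤ := ne_top_of_le_ne_top ENNReal.ofReal_ne_top h1
  have hxs : G.dist s x ≠ ⊤ :=
    ne_top_of_le_ne_top (ENNReal.add_ne_top.mpr ⟨a.2, hax⟩) (G.dist_triangle s a.1 x)
  refine ⟨hxs, le_antisymm ?_ (_root_.dist_triangle _ _ _)⟩
  have h3 : Dist.dist a (⟨x, hxs⟩ : G.Component s) ≤ G.walkLength (p.takeUntil x hx) :=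
    ENNReal.toReal_le_of_le_ofReal (G.walkLength_nonneg _) h1
  have h4 : Dist.dist (⟨x, hxs⟩ : G.Component s) b ≤ G.walkLength (p.dropUntil x hx) :=
    ENNReal.toReal_le_of_le_ofReal (G.walkLength_nonneg _) h2
  have h5 := hp.component_dist_eq G
  linarith

theorem HasLocalHubs.hasMetricHubs [Finite V] {c : ℝ} {η : ℕ} (h : G.HasLocalHubs c η) (s : V) :
    HasMetricHubs (G.Component s) c η := by
  classical
  intro r v hr
  obtain ⟨S, hS, -, H⟩ := h r v.1 hr
  refine ⟨S.preimage Component.val Component.val_injective.injOn, ?_, fun a b hab hball => ?_⟩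
  · rw [Finset.card_preimage]
    exact (Finset.card_filter_le _ _).trans hS
  obtain ⟨p, hp⟩ := G.exists_isShortestPath_of_dist_ne_top (Component.dist_ne_top a b)
  have hlen : r ≤ G.walkLength p := hab.trans_eq (hp.component_dist_eq G)
  obtain ⟨x, hx, hxS⟩ := H a.1 b.1 p hp hlen fun x hx => by
    obtain ⟨hxs, hx'⟩ := IsShortestPath.dist_add_dist G hp hx
    have := hball _ hx'
    change G.dist v.1 x ≤ ENNReal.ofReal (c * r)
    rw [← Component.ofReal_dist v ⟨x, hxs⟩]
    exact ENNReal.ofReal_le_ofReal this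
  obtain ⟨hxs, hx'⟩ := IsShortestPath.dist_add_dist G hp hx
  exact ⟨⟨x, hxs⟩, Finset.mem_preimage.mpr hxS, hx'⟩

theorem hasLocalHubs_of_highwayDimension_le {c : ℝ} {η : ℕ} (h : G.highwayDimension c ≤ η) :
    G.HasLocalHubs c η := by
  obtain ⟨η', hη', hle⟩ : ∃ η', G.HasLocalHubs c η' ∧ η' ≤ η := by
    by_contra! hcon
    have h1 : ((η + 1 : ℕ) : ℕ∞) ≤ G.highwayDimension c :=
      le_iInf₂ fun η' h' => by exact_mod_cast hcon η' h'
    have h2 : η + 1 ≤ η := by exact_mod_cast h1.trans h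
    omega
  intro r v hr
  obtain ⟨S, hS, H⟩ := hη' r v hr
  exact ⟨S, hS.trans hle, H⟩

/-- The graph that joins distinct vertices `u` and `v` of the component of `s` whenever `R u v` or
`R v u`, by an edge whose length is their distance in `G`. -/
noncomputable def shortcutGraph [Finite V] (s : V)
    (R : G.Component s → G.Component s → Prop) : LengthGraph V where
  graph :=
    { Adj := fun u v => u ≠ v ∧ ∃ x y : G.Component s, x.1 = u ∧ y.1 = v ∧ (R x y ∨ R y x)
      symm := ⟨fun _ _ ⟨hne, x, y, hx, hy, h⟩ => ⟨hne.symm, y, x, hy, hx, h.symm⟩⟩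
      loopless := ⟨fun _ h => h.1 rfl⟩ }
  len := Sym2.lift ⟨fun u v => (G.dist u v).toReal, fun u v => congrArg _ (G.dist_comm u v)⟩
  len_pos := by
    intro e
    induction e using Sym2.ind with
    | _ u v =>
      rintro ⟨hne, x, y, rfl, rfl, -⟩
      exact ENNReal.toReal_pos (fun h => hne (G.eq_of_dist_eq_zero h))
        (Component.dist_ne_top x y)

theorem dist_le_dist_shortcutGraph [Finite V] (s : V)
    (R : G.Component s → G.Component s → Prop) (u v : V) :
    G.dist u v ≤ (G.shortcutGraph s R).dist u v := by
  refine le_iInf fun p => ?_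
  induction p with
  | nil => simp [G.dist_self]
  | @cons a b d hadj q ih =>
    obtain ⟨-, x, y, rfl, rfl, -⟩ := id hadj
    have hlen : (G.shortcutGraph s R).len s(x.1, y.1) = (G.dist x.1 y.1).toReal := rfl
    rw [walkLength_cons, hlen, ENNReal.ofReal_add ENNReal.toReal_nonneg
      ((G.shortcutGraph s R).walkLength_nonneg q)]
    refine (G.dist_triangle _ y.1 _).trans (add_le_add ?_ ih)
    exact (ENNReal.ofReal_toReal (Component.dist_ne_top x y)).symm.le

theorem dist_shortcutGraph_le [Finite V] {s : V} {R : G.Component s → G.Component s → Prop}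
    {x y : G.Component s} (h : R x y ∨ R y x) :
    (G.shortcutGraph s R).dist x.1 y.1 ≤ ENNReal.ofReal (Dist.dist x y) := by
  by_cases hxy : x.1 = y.1
  · rw [hxy, LengthGraph.dist_self]
    exact bot_le
  have hadj : (G.shortcutGraph s R).graph.Adj x.1 y.1 := ⟨hxy, x, y, rfl, rfl, h⟩
  refine ((G.shortcutGraph s R).dist_le_walkLength (.cons hadj .nil)).trans (le_of_eq ?_)
  rw [walkLength_cons]
  simp only [walkLength, SimpleGraph.Walk.edges_nil, List.map_nil, List.sum_nil, add_zero]
  rfl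

/-- Bags in the component of `s` bound the treewidth of the whole graph, since the other vertices
are isolated. -/
theorem treewidth_shortcutGraph_le [Finite V] {κ : Type*} [LinearOrder κ] {s : V}
    {R : G.Component s → G.Component s → Prop} (key : G.Component s → κ) {w : ℕ}
    (hrefl : ∀ u, R u u) (hclosed : ∀ u x y, R u x → R u y → key x ≤ key y → R x y)
    (hcard : ∀ u, {x | R u x}.ncard ≤ w + 1) :
    treewidth (G.shortcutGraph s R).graph ≤ w := by
  classical
  have : Nonempty V := ⟨s⟩
  have hs : G.dist s s ≠ ⊤ := by simp [G.dist_self]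
  let R' : V → V → Prop := fun u v =>
    u = v ∨ ∃ x y : G.Component s, x.1 = u ∧ y.1 = v ∧ R x y
  let key' : V → κ := fun u => if h : G.dist s u ≠ ⊤ then key ⟨u, h⟩ else key ⟨s, hs⟩
  have hkey : ∀ x : G.Component s, key' x.1 = key x := fun x => dif_pos x.2
  have hR : ∀ x y : G.Component s, R' x.1 y.1 ↔ R x y := fun x y => by
    constructor
    · rintro (h | ⟨x', y', hx, hy, h⟩)
      · rw [← Component.val_injective h]; exact hrefl x
      · rwa [← Component.val_injective hx, ← Component.val_injective hy]
    · exact fun h => Or.inr ⟨x, y, rfl, rfl, h⟩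
  refine treewidth_le_of_elimination _ R' key' w (fun u => Or.inl rfl) ?_ ?_ ?_
  · rintro u x y hx hy hxy
    by_cases hu : G.dist s u = ⊤
    · have hout : ∀ z, R' u z → u = z := by
        rintro z (h | ⟨a, b, ha, -⟩)
        · exact h
        · exact absurd hu (ha ▸ a.2)
      exact Or.inl ((hout x hx).symm.trans (hout y hy))
    · have hin : ∀ z, R' u z → G.dist s z ≠ ⊤ := by
        rintro z (h | ⟨a, b, ha, hb, -⟩)
        · exact h ▸ hu
        · exact hb ▸ b.2
      have h1 := (hR ⟨u, hu⟩ ⟨x, hin x hx⟩).mp hx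
      have h2 := (hR ⟨u, hu⟩ ⟨y, hin y hy⟩).mp hy
      refine (hR ⟨x, hin x hx⟩ ⟨y, hin y hy⟩).mpr (hclosed _ _ _ h1 h2 ?_)
      rw [← hkey, ← hkey]
      exact hxy
  · intro u
    by_cases hu : G.dist s u = ⊤
    · have hsub : {x | R' u x} ⊆ {u} := by
        rintro z (h | ⟨a, b, ha, -⟩)
        · exact h.symm
        · exact absurd hu (ha ▸ a.2)
      refine (Set.ncard_le_ncard hsub).trans ?_
      rw [Set.ncard_singleton]
      omega
    · have hsub : {x | R' u x} ⊆ Component.val '' {x : G.Component s | R ⟨u, hu⟩ x} := by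
        rintro z (h | ⟨a, b, ha, hb, h⟩)
        · exact ⟨⟨u, hu⟩, hrefl _, h⟩
        · exact ⟨b, by rwa [← show a = ⟨u, hu⟩ from Component.val_injective ha], hb⟩
      refine (Set.ncard_le_ncard hsub).trans ((Set.ncard_image_le ?_).trans (hcard _))
      exact Set.Finite.of_finite_image (f := Component.val) (Set.toFinite _)
        Component.val_injective.injOn
  · rintro u v ⟨-, x, y, hx, hy, h | h⟩
    · exact Or.inl (Or.inr ⟨x, y, hx, hy, h⟩)
    · exact Or.inr (Or.inr ⟨y, x, hy, hx, h⟩)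

end LengthGraph

theorem theorem3 (c : ℝ) (hc : 4 < c) :
    ∃ f : ℝ → ℕ → ℕ, ∀ (ε : ℝ), 0 < ε → ∀ (η : ℕ) (V : Type*) [Finite V] (G : LengthGraph V),
      G.highwayDimension c ≤ η → ∀ s : V,
        ∃ (H : LengthGraph V) (φ : V → V),
          treewidth H.graph ≤ f ε η ∧
          ∀ u v : V,
            G.dist u v ≤ H.dist (φ u) (φ v) ∧
            H.dist (φ u) (φ v) ≤
              G.dist u v + ENNReal.ofReal ε * (G.dist s u + G.dist s v) := by
  have hw : ∀ (ε : ℝ) (η : ℕ), ∃ w : ℕ, 0 < ε → _ := fun ε η => by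
    by_cases hε : 0 < ε
    · obtain ⟨w, hw⟩ := exists_elimination_scheme hc hε η
      exact ⟨w, fun _ => hw⟩
    · exact ⟨0, fun h => absurd h hε⟩
  choose f hf using hw
  refine ⟨f, fun ε hε η V _ G hG s => ?_⟩
  have hs : G.dist s s ≠ ⊤ := by simp [G.dist_self]
  obtain ⟨R, key, hrefl, hclosed, hcard, hdist⟩ := hf ε η hε (G.Component s) ⟨s, hs⟩
    ((G.hasLocalHubs_of_highwayDimension_le hG).hasMetricHubs G s)
  refine ⟨G.shortcutGraph s R, id, G.treewidth_shortcutGraph_le key hrefl hclosed hcard,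
    fun u v => ⟨G.dist_le_dist_shortcutGraph s R u v, ?_⟩⟩
  have hε' : ENNReal.ofReal ε ≠ 0 := by simpa using hε
  by_cases hu : G.dist s u = ⊤
  · simp [hu, ENNReal.mul_top hε']
  by_cases hv : G.dist s v = ⊤
  · simp [hv, ENNReal.mul_top hε']
  obtain ⟨x, hux, hvx, hle⟩ := hdist ⟨u, hu⟩ ⟨v, hv⟩
  calc (G.shortcutGraph s R).dist u v
      ≤ (G.shortcutGraph s R).dist u x.1 + (G.shortcutGraph s R).dist x.1 v :=
        LengthGraph.dist_triangle _ _ _ _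
    _ ≤ ENNReal.ofReal (dist (⟨u, hu⟩ : G.Component s) x) +
          ENNReal.ofReal (dist x (⟨v, hv⟩ : G.Component s)) :=
        add_le_add (G.dist_shortcutGraph_le hux) (G.dist_shortcutGraph_le hvx.symm)
    _ ≤ ENNReal.ofReal (dist (⟨u, hu⟩ : G.Component s) ⟨v, hv⟩ +
          ε * (dist (⟨s, hs⟩ : G.Component s) ⟨u, hu⟩ +
            dist (⟨s, hs⟩ : G.Component s) ⟨v, hv⟩)) := by
        rw [← ENNReal.ofReal_add dist_nonneg dist_nonneg]
        exact ENNReal.ofReal_le_ofReal hle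
    _ = G.dist u v + ENNReal.ofReal ε * (G.dist s u + G.dist s v) := by
        rw [ENNReal.ofReal_add dist_nonneg (by positivity), ENNReal.ofReal_mul hε.le,
          ENNReal.ofReal_add dist_nonneg dist_nonneg, LengthGraph.Component.ofReal_dist,
          LengthGraph.Component.ofReal_dist, LengthGraph.Component.ofReal_dist]
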